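/- Let $\mathbb{N}=\{1,2,3,\dots\}$. A set $B\subseteq\mathbb{N}$ is an $IP$-set if there is a sequence $(x_t)_{t\ge 1}$ in $\mathbb{N}$ with $\sum_{t\in H}x_t\in B$ for every nonempty finite $H\subseteq\mathbb{N}$; a set $A\subseteq\mathbb{N}$ is an $IP^{\star}$-set if it meets every $IP$-set. A measure preserving system $(X,\mathcal{B},\mu,T)$ consists of a probability space $(X,\mathcal{B},\mu)$ and a measurable map $T:X\to X$ (not necessarily invertible) with $\mu(T^{-1}B)=\mu(B)$ for all $B\in\mathcal{B}$. It is called mild mixing if for all $\varepsilon>0$ and all $A,B\in\mathcal{B}$ with $\mu(A)\mu(B)>0$ the set $\{n\in\mathbb{N}:|\mu(A\cap T^{-n}B)-\mu(A)\mu(B)|<\varepsilon\}$ is an $IP^{\star}$-set. For $k\in\mathbb{N}$, a set $C\subseteq\mathbb{N}$ is called a $k$-$MIP^{\star}$-set if there are a mild mixing system $(X,\mathcal{B},\mu,T)$ and $A_0,\dots,A_k\in\mathcal{B}$ with $\mu(A_0)\mu(A_1)\cdots\mu(A_k)>0$ such that $$\Big\{n\in\mathbb{N}:\mu\Big(\bigcap_{i=0}^{k}T^{-in}A_i\Big)>0\Big\}\subseteq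 C.$$ **Theorem.** For every $k\in\mathbb{N}$, the collection $\mathcal{F}$ of all $k$-$MIP^{\star}$-sets is a $ZFSP$ family; that is, $\emptyset\notin\mathcal{F}$ and - (a) every $A\in\mathcal{F}$ is an $IP^{\star}$-set in $(\mathbb{N},+)$; - (b) for every $A\in\mathcal{F}$ there is $C\in\mathcal{F}$ with $C\subseteq A$ such that $-n+C=\{m\in\mathbb{N}:n+m\in C\}\in\mathcal{F}$ for all $n\in C$; - (c) if $A,B\in\mathcal{F}$, then $A\cap B\in\mathcal{F}$; - (d) if $n\in\mathbb{N}$ and $A\in\mathcal{F}$, then $n^{-1}A=\{m\in\mathbb{N}:nm\in A\}\in\mathcal{F}$. -/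

import Mathlib

open MeasureTheory

universe u

/-- A set of positive integers is an IP-set if it contains all sums over nonempty finite sets of
indices of some sequence of positive integers (not necessarily with distinct terms). -/
def IsIPSet (A : Set ℕ+) : Prop :=
  ∃ x : Stream' ℕ+, Hindman.FS x ⊆ A

/-- A set of positive integers is an IP*-set if it meets every IP-set. -/
def IsIPStarSet (A : Set ℕ+) : Prop :=
  ∀ B : Set ℕ+, IsIPSet B → (A ∩ B).Nonempty

/-- A family of nonempty sets of positive integers is a zigzag finite sums and products family. -/
structure IsZFSPFamily (F : Set (Set ℕ+)) : Prop where
  empty_notMem : ∅ ∉ F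
  isIPStarSet : ∀ A ∈ F, IsIPStarSet A
  exists_subset_shift : ∀ A ∈ F, ∃ C ∈ F, C ⊆ A ∧ ∀ n ∈ C, {m : ℕ+ | n + m ∈ C} ∈ F
  inter_mem : ∀ A ∈ F, ∀ B ∈ F, A ∩ B ∈ F
  dilate_mem : ∀ n : ℕ+, ∀ A ∈ F, {m : ℕ+ | n * m ∈ A} ∈ F

/-- A mild mixing system: a measure preserving transformation `T` (not necessarily invertible) of a
probability space such that for measurable `A`, `B` of positive measure and `ε > 0` the set of `n`
with `|μ(A ∩ T⁻ⁿ B) - μ(A) μ(B)| < ε` is an IP*-set. -/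
structure IsMildMixing {X : Type*} [MeasurableSpace X] (T : X → X) (μ : Measure X) : Prop where
  isProbabilityMeasure : IsProbabilityMeasure μ
  measurePreserving : MeasurePreserving T μ μ
  isIPStarSet : ∀ ε : ℝ, 0 < ε → ∀ A B : Set X, MeasurableSet A → MeasurableSet B →
    0 < μ A * μ B →
    IsIPStarSet {n : ℕ+ | |μ.real (A ∩ T^[(n : ℕ)] ⁻¹' B) - μ.real A * μ.real B| < ε}

/-- `k`-MIP*-sets: supersets of `{n : μ(⋂ i ≤ k, T^{-in} A i) > 0}` for a mild mixing system and
measurable sets `A 0, …, A k` of positive measure. -/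
def IsMIPStarSet (k : ℕ) (C : Set ℕ+) : Prop :=
  ∃ (X : Type u) (_ : MeasurableSpace X) (T : X → X) (μ : Measure X) (A : Fin (k + 1) → Set X),
    IsMildMixing T μ ∧ (∀ i, MeasurableSet (A i)) ∧ 0 < ∏ i, μ (A i) ∧
      {n : ℕ+ | 0 < μ (⋂ i : Fin (k + 1), T^[(i : ℕ) * (n : ℕ)] ⁻¹' A i)} ⊆ C

/-! A set is IP* exactly when it belongs to every idempotent ultrafilter p on ℕ+. Mild mixing
therefore says that μ(A ∩ T⁻ⁿB) → μ(A)μ(B) along each such p.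

A van der Corput argument along p, inside an induction on k, upgrades this to μ(⋂ T^{-in}A_i) → ∏
μ(A_i) (`IsMildMixing.tendsto_measureReal_iInter`). The limit is positive, so every k-MIP*-set lies
in every p; this gives (a), and hence ∅ ∉ F.

The rest changes the system: shifts replace A_i by T^{-in}A_i, intersections use product systems
(`IsMildMixing.prod`), and dilations use powers of T (`IsMildMixing.iterate`). -/

open Filter Topology

/-! ### Idempotent ultrafilters and IP*-sets. -/

section Ultrafilter

/-- An ultrafilter on the positive integers which is idempotent for the addition of ultrafilters. -/
def IsIdempotentUltrafilter (p : Ultrafilter ℕ+) : Prop :=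
  ∀ P : ℕ+ → Prop, (∀ᶠ m in p, ∀ᶠ n in p, P (m + n)) ↔ ∀ᶠ m in p, P m

theorem isIdempotentUltrafilter_of_add_self {p : Ultrafilter ℕ+}
    (hp : let := Ultrafilter.add (M := ℕ+); p + p = p) : IsIdempotentUltrafilter p := by
  intro P
  have h := Ultrafilter.eventually_add p p P
  rw [hp] at h
  exact h.symm

theorem IsIdempotentUltrafilter.add_self {p : Ultrafilter ℕ+} (hp : IsIdempotentUltrafilter p) :
    let := Ultrafilter.add (M := ℕ+); p + p = p := by
  letI := Ultrafilter.add (M := ℕ+)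
  refine Ultrafilter.coe_inj.mp (Filter.ext' fun P => ?_)
  rw [Ultrafilter.eventually_add]
  exact hp P

/-- Multiplication by a positive integer maps idempotent ultrafilters to idempotent ones. -/
theorem IsIdempotentUltrafilter.map_mul {p : Ultrafilter ℕ+} (hp : IsIdempotentUltrafilter p)
    (k : ℕ+) : IsIdempotentUltrafilter (p.map (k * ·)) := by
  intro P
  simp only [Ultrafilter.coe_map, eventually_map, ← mul_add]
  exact hp fun m => P (k * m)

/-- A set is an IP*-set iff it belongs to every idempotent ultrafilter. -/
theorem isIPStarSet_iff {S : Set ℕ+} :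
    IsIPStarSet S ↔ ∀ p : Ultrafilter ℕ+, IsIdempotentUltrafilter p → ∀ᶠ n in p, n ∈ S := by
  constructor
  · intro hS p hp
    by_contra h
    have h' : Sᶜ ∈ p := Ultrafilter.compl_mem_iff_notMem.mpr h
    obtain ⟨a, ha⟩ := Hindman.exists_FS_of_large p hp.add_self _ h'
    obtain ⟨n, hn, hn'⟩ := hS Sᶜ ⟨a, ha⟩
    exact hn' hn
  · rintro h B ⟨x, hx⟩
    obtain ⟨p, hp, hpx⟩ := Hindman.exists_idempotent_ultrafilter_le_FS x
    obtain ⟨n, hn, hn'⟩ :=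
      ((h p (isIdempotentUltrafilter_of_add_self hp)).and hpx).exists
    exact ⟨n, hn, hx hn'⟩

/-- If `R h m` holds for `p`-most `m`, for `p`-most `h`, then there are arbitrarily long lists of
elements of a given `p`-large set in which any two entries have the form `h + m`, `m` with
`R h m`. -/
theorem IsIdempotentUltrafilter.exists_list {p : Ultrafilter ℕ+} (hp : IsIdempotentUltrafilter p)
    {P : ℕ+ → Prop} (hP : ∀ᶠ n in p, P n) {R : ℕ+ → ℕ+ → Prop}
    (hR : ∀ᶠ h in p, ∀ᶠ m in p, R h m) (N : ℕ) :
    ∃ L : List ℕ+, L.length = N ∧ (∀ a ∈ L, P a) ∧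
      L.Pairwise fun b a => ∃ h, a = h + b ∧ R h b := by
  set Q : ℕ+ → Prop := fun n => P n ∧ ∀ᶠ m in p, R n m with hQ
  set good : List ℕ+ → Prop := fun L => (∀ a ∈ L, Q a) ∧
      L.Pairwise fun b a => ∃ h, a = h + b ∧ R h b with hgood
  have hQp : ∀ᶠ n in p, Q n := hP.and hR
  -- The invariant also asks that p-most translates be good, so that L can be shifted by n and n put
  -- in front; n + s and n differ by s, whence the condition R s n.
  suffices H : ∃ L : List ℕ+, L.length = N ∧ good L ∧ ∀ᶠ n in p, good (L.map (n + ·)) by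
    obtain ⟨L, h1, h2, -⟩ := H
    exact ⟨L, h1, fun a ha => (h2.1 a ha).1, h2.2⟩
  induction N with
  | zero => exact ⟨[], rfl, by simp [hgood], by simp [hgood]⟩
  | succ N ih =>
    obtain ⟨L, hL, hg, hn⟩ := ih
    have hR' : ∀ᶠ n in p, ∀ s ∈ L, R s n := by
      have : ∀ s ∈ L.toFinset, ∀ᶠ n in p, R s n := fun s hs => (hg.1 s (by simpa using hs)).2
      simpa using (eventually_all_finset L.toFinset).2 this
    have key : ∀ n, Q n → (∀ s ∈ L, R s n) → good (L.map (n + ·)) →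
        good (n :: L.map (n + ·)) := by
      intro n h1 h2 h3
      refine ⟨?_, List.pairwise_cons.2 ⟨?_, h3.2⟩⟩
      · intro a ha
        rcases List.mem_cons.1 ha with rfl | ha
        · exact h1
        · exact h3.1 a ha
      · intro a ha
        obtain ⟨s, hs, rfl⟩ := List.mem_map.1 ha
        exact ⟨s, add_comm _ _, h2 s hs⟩
    have hall : ∀ᶠ n in p, good (n :: L.map (n + ·)) := by
      filter_upwards [hQp, hR', hn] with n h1 h2 h3 using key n h1 h2 h3
    -- Idempotence restores the invariant: the new list translated by m is the one built from n + m.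
    obtain ⟨n, h1, h2⟩ := (hall.and ((hp _).2 hall)).exists
    refine ⟨n :: L.map (n + ·), by simp [hL], h1, ?_⟩
    filter_upwards [h2] with m hm
    have e : List.map (m + ·) (n :: L.map (n + ·)) = (m + n) :: L.map (m + n + ·) := by
      simp [Function.comp_def, add_assoc]
    rw [e, add_comm m n]
    exact hm

end Ultrafilter

/-! ### Van der Corput's lemma along p. -/

section VanDerCorput

variable {E : Type*} [NormedAddCommGroup E] [InnerProductSpace ℝ E]

/-- Expand the square: each diagonal term is at most C², each unordered pair contributes at most 2δ.
-/
theorem norm_sq_list_sum_le {ι : Type*} {u : ι → E} {C δ : ℝ} (hu : ∀ n, ‖u n‖ ≤ C) (hδ : 0 ≤ δ)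
    {L : List ι} (hL : L.Pairwise fun b a => inner ℝ (u b) (u a) ≤ δ) :
    ‖(L.map u).sum‖ ^ 2 ≤ L.length * C ^ 2 + (L.length : ℝ) ^ 2 * δ := by
  have aux : ∀ (b : ι) (L : List ι), (∀ a ∈ L, inner ℝ (u b) (u a) ≤ δ) →
      inner ℝ (u b) (L.map u).sum ≤ L.length * δ := by
    intro b L
    induction L with
    | nil => simp
    | cons a L ih =>
      intro h
      have h1 := ih fun x hx => h x (List.mem_cons_of_mem _ hx)
      have h2 := h a List.mem_cons_self
      simp only [List.map_cons, List.sum_cons, inner_add_right, List.length_cons, Nat.cast_add,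
        Nat.cast_one]
      linarith
  induction L with
  | nil => simp
  | cons b L ih =>
    rw [List.pairwise_cons] at hL
    have h1 := ih hL.2
    have h2 := aux b L hL.1
    have h3 : ‖u b‖ ^ 2 ≤ C ^ 2 := pow_le_pow_left₀ (norm_nonneg _) (hu b) 2
    simp only [List.map_cons, List.sum_cons, List.length_cons, Nat.cast_add, Nat.cast_one]
    rw [norm_add_sq_real]
    nlinarith

/-- The van der Corput lemma along an idempotent ultrafilter. -/
theorem IsIdempotentUltrafilter.tendsto_inner_zero {p : Ultrafilter ℕ+}
    (hp : IsIdempotentUltrafilter p) {u : ℕ+ → E} {C : ℝ} (hu : ∀ n, ‖u n‖ ≤ C)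
    (h : ∀ δ > 0, ∀ᶠ k in p, ∀ᶠ m in p, inner ℝ (u m) (u (k + m)) ≤ δ) (v : E) :
    Tendsto (fun n => inner ℝ v (u n)) p (𝓝 0) := by
  have main : ∀ v : E, ∀ ε > 0, ∀ᶠ n in p, inner ℝ v (u n) < ε := by
    intro v ε hε
    by_contra hcon
    rw [← Ultrafilter.eventually_not] at hcon
    simp only [not_lt] at hcon
    -- Sum N vectors with inner product at least ε with v and pairwise inner products at most δ.
    -- Once C² < Nδ, the sum has squared norm below 2N²δ, while (Nε)² = 2N²δ(‖v‖² + 1) contradicts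
    -- Cauchy–Schwarz.
    set δ : ℝ := ε ^ 2 / (2 * (‖v‖ ^ 2 + 1)) with hδ
    have hv : 0 < ‖v‖ ^ 2 + 1 := by positivity
    have hδ0 : 0 < δ := by positivity
    have hδv : δ * (2 * (‖v‖ ^ 2 + 1)) = ε ^ 2 := by rw [hδ]; field_simp
    obtain ⟨N, hN⟩ := exists_nat_gt (C ^ 2 / δ)
    have hN' : C ^ 2 < N * δ := by rwa [div_lt_iff₀ hδ0] at hN
    have hN0 : (0 : ℝ) < N := lt_of_le_of_lt (by positivity) hN
    obtain ⟨L, hL, hLP, hLR⟩ := hp.exists_list hcon (h δ hδ0) N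
    have h1 : ‖(L.map u).sum‖ ^ 2 ≤ N * C ^ 2 + (N : ℝ) ^ 2 * δ := by
      rw [← hL]
      refine norm_sq_list_sum_le hu hδ0.le (hLR.imp ?_)
      rintro b a ⟨k, rfl, hk⟩
      exact hk
    have h2 : N * ε ≤ inner ℝ v (L.map u).sum := by
      rw [← hL]
      clear h1 hLR hL
      induction L with
      | nil => simp
      | cons a L ih =>
        have h1 := ih fun x hx => hLP x (List.mem_cons_of_mem _ hx)
        have h2 := hLP a List.mem_cons_self
        simp only [List.map_cons, List.sum_cons, inner_add_right, List.length_cons, Nat.cast_add,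
          Nat.cast_one]
        linarith
    have h3 : N * ε ≤ ‖v‖ * ‖(L.map u).sum‖ := h2.trans (real_inner_le_norm _ _)
    have h4 : (N * ε) ^ 2 ≤ ‖v‖ ^ 2 * ‖(L.map u).sum‖ ^ 2 := by
      rw [← mul_pow]; exact pow_le_pow_left₀ (by positivity) h3 2
    have h5 : ‖(L.map u).sum‖ ^ 2 < (N : ℝ) ^ 2 * (2 * δ) := by nlinarith
    have h6 : ‖v‖ ^ 2 * ‖(L.map u).sum‖ ^ 2 ≤ ‖v‖ ^ 2 * ((N : ℝ) ^ 2 * (2 * δ)) := by gcongr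
    have h7 : (N * ε) ^ 2 = (N : ℝ) ^ 2 * (2 * δ) * (‖v‖ ^ 2 + 1) := by
      rw [mul_pow, ← hδv]; ring
    have h8 : 0 < (N : ℝ) ^ 2 * (2 * δ) := by positivity
    nlinarith
  rw [Metric.tendsto_nhds]
  intro ε hε
  filter_upwards [main v ε hε, main (-v) ε hε] with n h1 h2
  rw [inner_neg_left] at h2
  rw [dist_zero_right, Real.norm_eq_abs, abs_lt]
  constructor <;> linarith

end VanDerCorput

theorem exists_abs_prod_le {Y κ : Type*} [Fintype κ] {f : κ → Y → ℝ}
    (hb : ∀ i, ∃ C, ∀ x, |f i x| ≤ C) : ∃ C, ∀ y : κ → Y, |∏ i, f i (y i)| ≤ C := by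
  choose C hC using hb
  refine ⟨∏ i, C i, fun y => ?_⟩
  rw [Finset.abs_prod]
  exact Finset.prod_le_prod (fun _ _ => abs_nonneg _) fun i _ => hC i _

/-! ### Mild mixing of sets, powers and products. -/

section Mixing

variable {X : Type*} [MeasurableSpace X]

/-- `T` is mixing along every idempotent ultrafilter iff it is mild mixing. -/
theorem isMildMixing_iff {T : X → X} {μ : Measure X} :
    IsMildMixing T μ ↔ IsProbabilityMeasure μ ∧ MeasurePreserving T μ μ ∧
      ∀ p : Ultrafilter ℕ+, IsIdempotentUltrafilter p → ∀ A B : Set X, MeasurableSet A →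
        MeasurableSet B →
        Tendsto (fun n : ℕ+ => μ.real (A ∩ T^[(n : ℕ)] ⁻¹' B)) p (𝓝 (μ.real A * μ.real B)) := by
  constructor
  · intro h
    have := h.isProbabilityMeasure
    refine ⟨h.isProbabilityMeasure, h.measurePreserving, fun p hp A B hA hB => ?_⟩
    -- The definition says nothing about null sets, for which both sides vanish.
    rcases eq_or_ne (μ A) 0 with h0 | hA0
    · have : ∀ n : ℕ+, μ.real (A ∩ T^[(n : ℕ)] ⁻¹' B) = 0 := fun n => by
        rw [measureReal_def, measure_mono_null Set.inter_subset_left h0, ENNReal.toReal_zero]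
      simp [this, measureReal_def, h0]
    rcases eq_or_ne (μ B) 0 with h0 | hB0
    · have : ∀ n : ℕ+, μ.real (A ∩ T^[(n : ℕ)] ⁻¹' B) = 0 := fun n => by
        rw [measureReal_def, measure_mono_null Set.inter_subset_right, ENNReal.toReal_zero]
        rw [(h.measurePreserving.iterate n).measure_preimage hB.nullMeasurableSet, h0]
      simp [this, measureReal_def, h0]
    rw [Metric.tendsto_nhds]
    intro ε hε
    exact isIPStarSet_iff.1 (h.isIPStarSet ε hε A B hA hB
      (pos_iff_ne_zero.2 (mul_ne_zero hA0 hB0))) p hp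
  · rintro ⟨h1, h2, h3⟩
    refine ⟨h1, h2, fun ε hε A B hA hB _ => isIPStarSet_iff.2 fun p hp => ?_⟩
    exact Metric.tendsto_nhds.1 (h3 p hp A B hA hB) ε hε

/-- Powers of a mild mixing transformation are mild mixing. -/
theorem IsMildMixing.iterate {T : X → X} {μ : Measure X} (h : IsMildMixing T μ) (k : ℕ+) :
    IsMildMixing T^[(k : ℕ)] μ := by
  rw [isMildMixing_iff] at h ⊢
  refine ⟨h.1, h.2.1.iterate k, fun p hp A B hA hB => ?_⟩
  have := h.2.2 _ (hp.map_mul k) A B hA hB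
  rw [Ultrafilter.coe_map, tendsto_map'_iff] at this
  simpa only [Function.comp_def, PNat.mul_coe, Function.iterate_mul] using this

/-- Mixing along a filter passes from a generating π-system to all measurable sets. -/
theorem tendsto_measureReal_inter_of_piSystem {ι : Type*} {l : Filter ι} {μ : Measure X}
    [IsProbabilityMeasure μ] {S : ι → X → X} (hS : ∀ n, MeasurePreserving (S n) μ μ)
    {s : Set (Set X)} (hs : ‹MeasurableSpace X› = MeasurableSpace.generateFrom s)
    (hpi : IsPiSystem s)
    (h : ∀ A ∈ s, ∀ B ∈ s,
      Tendsto (fun n => μ.real (A ∩ S n ⁻¹' B)) l (𝓝 (μ.real A * μ.real B)))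
    {A B : Set X} (hA : MeasurableSet A) (hB : MeasurableSet B) :
    Tendsto (fun n => μ.real (A ∩ S n ⁻¹' B)) l (𝓝 (μ.real A * μ.real B)) := by
  have hsm : ∀ A ∈ s, MeasurableSet A := fun A hA => by
    rw [hs]; exact MeasurableSpace.measurableSet_generateFrom hA
  have hpre : ∀ n {B : Set X}, MeasurableSet B → μ.real (S n ⁻¹' B) = μ.real B := fun n B hB => by
    rw [measureReal_def, (hS n).measure_preimage hB.nullMeasurableSet, measureReal_def]
  have hsum : ∀ f : ℕ → Set X, Pairwise (Function.onFun Disjoint f) →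
      (∀ i, MeasurableSet (f i)) → HasSum (fun i => μ.real (f i)) (μ.real (⋃ i, f i)) :=
    fun f hf hfm => by
      have h := measure_iUnion hf hfm (μ := μ)
      rw [measureReal_def, h, ENNReal.tsum_toReal_eq fun i => measure_ne_top _ _]
      exact (ENNReal.summable_toReal (h ▸ measure_ne_top _ _)).hasSum
  -- The π-λ argument runs twice, first in B and then in A; disjoint unions are handled by dominated
  -- convergence with the summable bound μ(f i).
  have step : ∀ A ∈ s, ∀ B, MeasurableSet B →
      Tendsto (fun n => μ.real (A ∩ S n ⁻¹' B)) l (𝓝 (μ.real A * μ.real B)) := by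
    intro A hA B hB
    have hAm := hsm A hA
    induction B, hB using MeasurableSpace.induction_on_inter hs hpi with
    | empty => simpa using tendsto_const_nhds
    | basic B hB => exact h A hA B hB
    | compl B hB ih =>
      have e : ∀ n, μ.real (A ∩ S n ⁻¹' Bᶜ) = μ.real A - μ.real (A ∩ S n ⁻¹' B) := fun n => by
        rw [Set.preimage_compl, ← Set.sdiff_eq, eq_sub_iff_add_eq,
          measureReal_sdiff_add_inter ((hS n).measurable hB)]
      simp only [e, probReal_compl_eq_one_sub hB, mul_sub, mul_one]
      exact ih.const_sub _
    | iUnion f hf hfm ih =>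
      have e : ∀ n, μ.real (A ∩ S n ⁻¹' ⋃ i, f i) = ∑' i, μ.real (A ∩ S n ⁻¹' f i) := fun n => by
        rw [Set.preimage_iUnion, Set.inter_iUnion]
        refine (hsum _ (fun i j hij => ?_) fun i => hAm.inter ((hS n).measurable (hfm i))).tsum_eq.symm
        exact ((hf hij).preimage _).mono Set.inter_subset_right Set.inter_subset_right
      simp only [e]
      rw [← ((hsum f hf hfm).mul_left _).tsum_eq]
      refine tendsto_tsum_of_dominated_convergence (hsum f hf hfm).summable ih
        (.of_forall fun n i => ?_)
      rw [Real.norm_eq_abs, abs_of_nonneg measureReal_nonneg, ← hpre n (hfm i)]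
      exact measureReal_mono Set.inter_subset_right
  induction A, hA using MeasurableSpace.induction_on_inter hs hpi with
  | empty => simpa using tendsto_const_nhds
  | basic A hA => exact step A hA B hB
  | compl A hA ih =>
    have e : ∀ n, μ.real (Aᶜ ∩ S n ⁻¹' B) = μ.real B - μ.real (A ∩ S n ⁻¹' B) := fun n => by
      rw [Set.inter_comm, ← Set.sdiff_eq, eq_sub_iff_add_eq, Set.inter_comm A,
        measureReal_sdiff_add_inter hA, hpre n hB]
    simp only [e, probReal_compl_eq_one_sub hA, sub_mul, one_mul]
    exact ih.const_sub _
  | iUnion f hf hfm ih =>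
    have e : ∀ n, μ.real ((⋃ i, f i) ∩ S n ⁻¹' B) = ∑' i, μ.real (f i ∩ S n ⁻¹' B) := fun n => by
      rw [Set.iUnion_inter]
      refine (hsum _ (fun i j hij => ?_) fun i => (hfm i).inter ((hS n).measurable hB)).tsum_eq.symm
      exact (hf hij).mono Set.inter_subset_left Set.inter_subset_left
    simp only [e]
    rw [← ((hsum f hf hfm).mul_right _).tsum_eq]
    refine tendsto_tsum_of_dominated_convergence (hsum f hf hfm).summable ih
      (.of_forall fun n i => ?_)
    rw [Real.norm_eq_abs, abs_of_nonneg measureReal_nonneg]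
    exact measureReal_mono Set.inter_subset_left

/-- The product of two mild mixing systems is mild mixing. -/
theorem IsMildMixing.prod {Y : Type*} [MeasurableSpace Y] {T : X → X} {μ : Measure X}
    {S : Y → Y} {ν : Measure Y} (hT : IsMildMixing T μ) (hS : IsMildMixing S ν) :
    IsMildMixing (Prod.map T S) (μ.prod ν) := by
  rw [isMildMixing_iff] at hT hS ⊢
  obtain ⟨_, hT2, hT3⟩ := hT
  obtain ⟨_, hS2, hS3⟩ := hS
  refine ⟨inferInstance, hT2.prod hS2, fun p hp A B hA hB => ?_⟩
  refine tendsto_measureReal_inter_of_piSystem (S := fun n : ℕ+ => (Prod.map T S)^[(n : ℕ)])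
    (fun n => (hT2.prod hS2).iterate n) generateFrom_prod.symm isPiSystem_prod ?_ hA hB
  rintro _ ⟨A, hA, A', hA', rfl⟩ _ ⟨B, hB, B', hB', rfl⟩
  rw [measureReal_prod_prod, measureReal_prod_prod, mul_mul_mul_comm]
  refine ((hT3 p hp A B hA hB).mul (hS3 p hp A' B' hA' hB')).congr fun n => ?_
  rw [← measureReal_prod_prod, ← Set.prod_inter_prod, Prod.map_iterate,
    Set.preimage_prod_map_prod]

/-! ### From sets to functions. -/

/-- Weak convergence of the functionals `f ↦ ∫ f(S n x) G n x`, where the `S n` preserve the measure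
and the `G n` are uniformly bounded, to a multiple of the integral follows from convergence on
indicator functions. -/
theorem tendsto_integral_comp_mul_of_setIntegral {ι : Type*} {l : Filter ι} {μ : Measure X}
    [IsFiniteMeasure μ] {S : ι → X → X} (hS : ∀ n, MeasurePreserving (S n) μ μ)
    {G : ι → X → ℝ} (hG : ∀ n, Measurable (G n)) {C : ℝ} (hC : ∀ n x, |G n x| ≤ C) {c : ℝ}
    (h : ∀ s, MeasurableSet s →
      Tendsto (fun n => ∫ x in S n ⁻¹' s, G n x ∂μ) l (𝓝 (μ.real s * c)))
    {f : X → ℝ} (hf : Integrable f μ) :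
    Tendsto (fun n => ∫ x, f (S n x) * G n x ∂μ) l (𝓝 ((∫ x, f x ∂μ) * c)) := by
  have hcomp : ∀ {f : X → ℝ} (n), Integrable f μ → Integrable (fun x => f (S n x)) μ :=
    fun {f} n hf => (hS n).integrable_comp_of_integrable hf
  have hint : ∀ {f : X → ℝ} (n), Integrable f μ → Integrable (fun x => f (S n x) * G n x) μ :=
    fun {f} n hf => (hcomp n hf).mul_bdd (c := C) (hG n).aestronglyMeasurable
      (.of_forall fun x => by simpa using hC n x)
  have hmap : ∀ {f : X → ℝ} (n), Integrable f μ → ∫ x, f (S n x) ∂μ = ∫ x, f x ∂μ := by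
    intro f n hf
    have hf' := hf.aestronglyMeasurable
    rw [← (hS n).map_eq] at hf'
    rw [← integral_map (hS n).aemeasurable hf', (hS n).map_eq]
  refine Integrable.induction (fun f : X → ℝ => Tendsto (fun n => ∫ x, f (S n x) * G n x ∂μ) l
    (𝓝 ((∫ x, f x ∂μ) * c))) ?_ ?_ ?_ ?_ hf
  · intro a s hs _
    have e : ∀ n, ∫ x, s.indicator (fun _ => a) (S n x) * G n x ∂μ =
        a * ∫ x in S n ⁻¹' s, G n x ∂μ := fun n => by
      rw [← integral_const_mul, ← integral_indicator ((hS n).measurable hs)]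
      congr 1 with x
      by_cases hx : S n x ∈ s <;> simp [hx]
    simp only [e, integral_indicator_const a hs, smul_eq_mul]
    rw [mul_comm _ a, mul_assoc]
    exact (h s hs).const_mul a
  · intro f g _ hf hg ihf ihg
    have e : ∀ n, ∫ x, (f + g) (S n x) * G n x ∂μ =
        ∫ x, f (S n x) * G n x ∂μ + ∫ x, g (S n x) * G n x ∂μ :=
      fun n => by
        rw [← integral_add (hint n hf) (hint n hg)]
        simp [add_mul]
    simp only [e, integral_add' hf hg, add_mul]
    exact ihf.add ihg
  -- The functionals are Lipschitz on L¹ with constant |C|, uniformly in n, so convergence survives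
  -- L¹ limits.
  · refine isClosed_of_closure_subset fun f hf => ?_
    refine Metric.tendsto_nhds.2 fun ε hε => ?_
    set D : ℝ := |C| + |c| + 1
    have hD : 0 < D := by positivity
    obtain ⟨g, hg, hfg⟩ := Metric.mem_closure_iff.1 hf (ε / (2 * D)) (by positivity)
    have hg' := Metric.tendsto_nhds.1 hg (ε / 2) (by positivity)
    have hfi := L1.integrable_coeFn f
    have hgi := L1.integrable_coeFn g
    have hn : ∫ x, |f x - g x| ∂μ = dist f g := by
      rw [dist_eq_norm, L1.norm_eq_integral_norm]
      refine integral_congr_ae ?_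
      filter_upwards [Lp.coeFn_sub f g] with x hx
      rw [hx, Pi.sub_apply, Real.norm_eq_abs]
    filter_upwards [hg'] with n hn'
    rw [Real.dist_eq] at hn' ⊢
    have h1 : |∫ x, f (S n x) * G n x ∂μ - ∫ x, g (S n x) * G n x ∂μ| ≤ |C| * dist f g := by
      have hfgi : Integrable (fun x => |f x - g x|) μ := (hfi.sub hgi).abs
      rw [← integral_sub (hint n hfi) (hint n hgi), ← hn, ← hmap n hfgi, ← integral_const_mul]
      refine (abs_integral_le_integral_abs).trans
        (integral_mono ((hint n hfi).sub (hint n hgi)).abs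
          ((hcomp n hfgi).const_mul _) fun x => ?_)
      simp only [← sub_mul, abs_mul]
      rw [mul_comm]
      exact mul_le_mul_of_nonneg_right ((hC n x).trans (le_abs_self C)) (abs_nonneg _)
    have h2 : |(∫ x, f x ∂μ) * c - (∫ x, g x ∂μ) * c| ≤ |c| * dist f g := by
      rw [← sub_mul, abs_mul, mul_comm, ← integral_sub hfi hgi, ← hn]
      exact mul_le_mul_of_nonneg_left abs_integral_le_integral_abs (abs_nonneg _)
    have h3 : D * dist f g < ε / 2 := by
      calc D * dist f g < D * (ε / (2 * D)) := by gcongr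
        _ = ε / 2 := by field_simp
    have h4 : D * dist f g = |C| * dist f g + |c| * dist f g + dist f g := by
      simp only [D]; ring
    have h5 : 0 ≤ dist f g := dist_nonneg
    rw [abs_le] at h1 h2
    rw [abs_lt] at hn' ⊢
    constructor <;> linarith
  · intro f g hfg hf ih
    rw [← integral_congr_ae hfg]
    refine ih.congr fun n => integral_congr_ae ?_
    filter_upwards [(hS n).quasiMeasurePreserving.ae hfg] with x hx
    rw [hx]

/-- Mild mixing for pairs of bounded functions. -/
theorem IsMildMixing.tendsto_integral_mul {T : X → X} {μ : Measure X} (h : IsMildMixing T μ)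
    {p : Ultrafilter ℕ+} (hp : IsIdempotentUltrafilter p) {f g : X → ℝ} (hf : Integrable f μ)
    (hg : Measurable g) {C : ℝ} (hgC : ∀ x, |g x| ≤ C) :
    Tendsto (fun n : ℕ+ => ∫ x, f x * g (T^[(n : ℕ)] x) ∂μ) p
      (𝓝 ((∫ x, f x ∂μ) * ∫ x, g x ∂μ)) := by
  obtain ⟨_, hT, hmix⟩ := isMildMixing_iff.1 h
  have hTn := fun n : ℕ+ => hT.iterate (n : ℕ)
  -- The approximation lemma is used twice: here for f with S the identity, and in `key` for g
  -- against the indicator of s.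
  refine tendsto_integral_comp_mul_of_setIntegral (S := fun _ => id)
    (fun n => MeasurePreserving.id μ) (fun n => hg.comp (hTn n).measurable) (fun n x => hgC _) ?_ hf
  intro s hs
  have key := tendsto_integral_comp_mul_of_setIntegral (μ := μ) (l := (p : Filter ℕ+)) hTn
    (G := fun _ => s.indicator fun _ => (1 : ℝ)) (C := 1) (c := μ.real s)
    (fun _ => measurable_const.indicator hs)
    (fun _ x => by by_cases hx : x ∈ s <;> simp [hx]) ?_
    (Integrable.of_bound (μ := μ) hg.aestronglyMeasurable C (.of_forall hgC))
  · rw [mul_comm]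
    refine key.congr fun n => ?_
    rw [Set.preimage_id, ← integral_indicator hs]
    congr 1 with x
    by_cases hx : x ∈ s <;> simp [hx]
  · intro t ht
    rw [mul_comm]
    refine (hmix p hp s t hs ht).congr fun n => ?_
    rw [integral_indicator_const _ hs, measureReal_restrict_apply hs, smul_eq_mul, mul_one]

/-! ### Mixing of all orders. -/

/-- In `L²` of a finite measure, inner products of classes of functions are integrals. -/
theorem inner_toLp_eq_integral_mul {μ : Measure X} {f g : X → ℝ} (hf : MemLp f 2 μ)
    (hg : MemLp g 2 μ) : inner ℝ (hf.toLp f) (hg.toLp g) = ∫ x, f x * g x ∂μ := by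
  rw [L2.inner_def]
  refine integral_congr_ae ?_
  filter_upwards [hf.coeFn_toLp, hg.coeFn_toLp] with x hx hx'
  rw [hx, hx', real_inner_eq_re_inner, RCLike.inner_apply]
  simp [mul_comm]

/-- Mild mixing implies mild mixing of all orders. -/
theorem IsMildMixing.tendsto_integral_prod {T : X → X} {μ : Measure X} (h : IsMildMixing T μ)
    {p : Ultrafilter ℕ+} (hp : IsIdempotentUltrafilter p) (k : ℕ) (f : Fin (k + 1) → X → ℝ)
    (hf : ∀ i, Measurable (f i)) (hb : ∀ i, ∃ C, ∀ x, |f i x| ≤ C) :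
    Tendsto (fun n : ℕ+ => ∫ x, ∏ i, f i (T^[(i : ℕ) * n] x) ∂μ) p
      (𝓝 (∏ i, ∫ x, f i x ∂μ)) := by
  have := h.isProbabilityMeasure
  have hT := h.measurePreserving
  have hTm := fun n : ℕ => (hT.iterate n).measurable
  have hint : ∀ {f : X → ℝ}, Measurable f → (∃ C, ∀ x, |f x| ≤ C) → Integrable f μ :=
    fun hf ⟨C, hC⟩ => .of_bound hf.aestronglyMeasurable C (.of_forall hC)
  induction k with
  | zero => simp
  | succ k ih =>
    -- When a function other than f 0 has mean zero, apply van der Corput in L² to the product of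
    -- all factors but f 0, paired with v = f 0.
    have zero : ∀ (f : Fin (k + 2) → X → ℝ) (_ : ∀ i, Measurable (f i))
        (_ : ∀ i, ∃ C, ∀ x, |f i x| ≤ C) (i : Fin (k + 1)) (_ : ∫ x, f i.succ x ∂μ = 0),
        Tendsto (fun n : ℕ+ => ∫ x, ∏ i, f i (T^[(i : ℕ) * n] x) ∂μ) p (𝓝 0) := by
      intro f hf hb i hi
      set g : Fin (k + 1) → X → ℝ := fun i => f i.succ with hg
      have hgm : ∀ i, Measurable (g i) := fun i => hf _
      have hgb : ∀ i, ∃ C, ∀ x, |g i x| ≤ C := fun i => hb _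
      obtain ⟨C, hC⟩ := exists_abs_prod_le hgb
      set u : ℕ+ → X → ℝ := fun n x => ∏ i, g i (T^[((i : ℕ) + 1) * n] x) with hu
      have hum : ∀ n, Measurable (u n) := fun n =>
        Finset.measurable_fun_prod _ fun i _ => (hgm i).comp (hTm _)
      have huC : ∀ n x, |u n x| ≤ C := fun n x => hC _
      have huL : ∀ n, MemLp (u n) 2 μ := fun n =>
        .of_bound (hum n).aestronglyMeasurable C (.of_forall (huC n))
      obtain ⟨C0, hC0⟩ := hb 0
      have hvL : MemLp (f 0) 2 μ := .of_bound (hf 0).aestronglyMeasurable C0 (.of_forall hC0)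
      have hnorm : ∀ n, ‖(huL n).toLp (u n)‖ ≤ C := by
        intro n
        have := Lp.norm_le_of_ae_bound (f := (huL n).toLp (u n)) (C := C)
          ((abs_nonneg _).trans (huC 1 (Classical.choice μ.nonempty_of_neZero))) (by
            filter_upwards [(huL n).coeFn_toLp] with x hx
            rw [hx]
            exact huC n x)
        simpa [measureUnivNNReal] using this
      have hvdc := hp.tendsto_inner_zero hnorm ?_ (hvL.toLp (f 0))
      · refine hvdc.congr fun n => ?_
        rw [inner_toLp_eq_integral_mul]
        simp [Fin.prod_univ_succ, hu, hg]
      · intro δ hδ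
        set G : ℕ+ → Fin (k + 1) → X → ℝ :=
          fun l i y => g i y * g i (T^[((i : ℕ) + 1) * l] y) with hG
        have hGm : ∀ l i, Measurable (G l i) := fun l i =>
          (hgm i).mul ((hgm i).comp (hTm _))
        have hGb : ∀ l i, ∃ C, ∀ x, |G l i x| ≤ C := by
          intro l i
          obtain ⟨C, hC⟩ := hgb i
          refine ⟨C * C, fun x => ?_⟩
          rw [abs_mul]
          exact mul_le_mul (hC _) (hC _) (abs_nonneg _) ((abs_nonneg _).trans (hC x))
        -- Invariance under T^m lowers the exponents (i + 1)m to im, leaving one function fewer, so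
        -- the induction hypothesis applies in m.
        have hinner : ∀ l m, inner ℝ ((huL m).toLp (u m)) ((huL (l + m)).toLp (u (l + m))) =
            ∫ x, ∏ i, G l i (T^[(i : ℕ) * m] x) ∂μ := by
          intro l m
          rw [inner_toLp_eq_integral_mul]
          have hmeas : Measurable fun x => ∏ i, G l i (T^[(i : ℕ) * m] x) :=
            Finset.measurable_fun_prod _ fun i _ => (hGm l i).comp (hTm _)
          have hmp := hT.iterate (m : ℕ)
          conv_rhs => rw [← hmp.map_eq]
          rw [integral_map hmp.aemeasurable hmeas.aestronglyMeasurable]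
          refine integral_congr_ae (.of_forall fun x => ?_)
          simp only [hu, hG, ← Finset.prod_mul_distrib, ← Function.iterate_add_apply, PNat.add_coe]
          refine Finset.prod_congr rfl fun i _ => ?_
          congr 4 <;> ring
        have hlim : Tendsto (fun l => ∏ i, ∫ x, G l i x ∂μ) p
            (𝓝 (∏ i, ((∫ x, g i x ∂μ) * ∫ x, g i x ∂μ))) := by
          refine tendsto_finsetProd _ fun i _ => ?_
          obtain ⟨C, hC⟩ := hgb i
          -- Mixing along the multiples (i + 1)l holds because the image of p under multiplication
          -- by i + 1 is again idempotent.
          have := h.tendsto_integral_mul (hp.map_mul (Nat.succPNat i)) (hint (hgm i) (hgb i))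
            (hgm i) hC
          rw [Ultrafilter.coe_map, tendsto_map'_iff] at this
          exact this
        have h0 : ∏ i, ((∫ x, g i x ∂μ) * ∫ x, g i x ∂μ) = 0 :=
          Finset.prod_eq_zero (Finset.mem_univ i) (by simp [hg, hi])
        rw [h0] at hlim
        filter_upwards [hlim.eventually (gt_mem_nhds hδ)] with l hl
        filter_upwards [(ih (G l) (hGm l) (hGb l)).eventually (gt_mem_nhds hl)] with m hm
        rw [hinner]
        exact hm.le
    -- Split the last function into a mean-zero part, covered by `zero`, and the constant c, covered
    -- by the induction hypothesis.
    set c := ∫ x, f (Fin.last _) x ∂μ with hc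
    set f' : Fin (k + 2) → X → ℝ :=
      Function.update f (Fin.last _) fun x => f (Fin.last _) x - c with hf'
    have hfm' : ∀ i, Measurable (f' i) := by
      intro i
      rcases eq_or_ne i (Fin.last _) with rfl | hi
      · simpa [hf'] using (hf _).sub_const c
      · simpa [hf', hi] using hf i
    have hfb' : ∀ i, ∃ C, ∀ x, |f' i x| ≤ C := by
      intro i
      rcases eq_or_ne i (Fin.last _) with rfl | hi
      · obtain ⟨C, hC⟩ := hb (Fin.last _)
        refine ⟨C + |c|, fun x => ?_⟩
        simp only [hf', Function.update_self]
        exact (abs_sub _ _).trans (by gcongr; exact hC x)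
      · simpa [hf', hi] using hb i
    have hz := zero f' hfm' hfb' (Fin.last _) (by
      simp only [hf', Fin.succ_last, Function.update_self]
      rw [integral_sub (hint (hf _) (hb _)) (integrable_const _)]
      simp [hc])
    have hc' := (ih (fun i => f i.castSucc) (fun i => hf _) fun i => hb _).mul_const c
    have hsum := hz.add hc'
    rw [zero_add] at hsum
    rw [Fin.prod_univ_castSucc]
    refine hsum.congr fun n => ?_
    have hprod : ∀ {j : ℕ} {F : Fin j → X → ℝ}, (∀ i, Measurable (F i)) →
        (∀ i, ∃ C, ∀ x, |F i x| ≤ C) → Integrable (fun x => ∏ i, F i (T^[(i : ℕ) * n] x)) μ := by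
      intro j F hF hFb
      obtain ⟨C, hC⟩ := exists_abs_prod_le hFb
      exact hint (Finset.measurable_fun_prod _ fun i _ => (hF i).comp (hTm _)) ⟨C, fun x => hC _⟩
    rw [← integral_mul_const, ← integral_add (hprod hfm' hfb')
      ((hprod (F := fun i => f i.castSucc) (fun i => hf _) fun i => hb _).mul_const c)]
    congr 1 with x
    simp only [Fin.prod_univ_castSucc, hf', Function.update_self, Fin.val_castSucc,
      ne_eq, Fin.castSucc_ne_last, not_false_eq_true, Function.update_of_ne]
    ring

/-- Mild mixing of all orders along idempotent ultrafilters, for sets. -/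
theorem IsMildMixing.tendsto_measureReal_iInter {T : X → X} {μ : Measure X}
    (h : IsMildMixing T μ) {p : Ultrafilter ℕ+} (hp : IsIdempotentUltrafilter p) {k : ℕ}
    {A : Fin (k + 1) → Set X} (hA : ∀ i, MeasurableSet (A i)) :
    Tendsto (fun n : ℕ+ => μ.real (⋂ i : Fin (k + 1), T^[(i : ℕ) * (n : ℕ)] ⁻¹' A i)) p
      (𝓝 (∏ i, μ.real (A i))) := by
  have key := h.tendsto_integral_prod hp k (fun i => (A i).indicator 1)
    (fun i => measurable_one.indicator (hA i))
    fun i => ⟨1, fun x => by by_cases hx : x ∈ A i <;> simp [hx]⟩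
  simp only [integral_indicator_one (hA _)] at key
  refine key.congr fun n => ?_
  rw [← integral_indicator_one (MeasurableSet.iInter fun i =>
    (h.measurePreserving.iterate _).measurable (hA i))]
  congr 1 with x
  classical
  simp only [Set.indicator_apply, Set.mem_iInter, Set.mem_preimage, Pi.one_apply,
    Finset.prod_ite_zero, Finset.mem_univ, true_imp_iff, Finset.prod_const_one]

end Mixing

/-! ### Closure properties of k-MIP*-sets. -/

section MIPStar

theorem IsMIPStarSet.isIPStarSet {k : ℕ} {C : Set ℕ+} (hC : IsMIPStarSet.{u} k C) :
    IsIPStarSet C := by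
  obtain ⟨X, _, T, μ, A, hT, hA, hpos, hsub⟩ := hC
  have := hT.isProbabilityMeasure
  refine isIPStarSet_iff.2 fun p hp => ?_
  have h0 : 0 < ∏ i, μ.real (A i) := Finset.prod_pos fun i hi =>
    ENNReal.toReal_pos (Finset.prod_ne_zero_iff.1 hpos.ne' i hi) (measure_ne_top _ _)
  filter_upwards [(hT.tendsto_measureReal_iInter hp hA).eventually (lt_mem_nhds h0)] with n hn
  exact hsub (ENNReal.toReal_pos_iff.1 hn).1

/-- D is the return set itself. Its shift by n is the return set of the sets T^{-in}A_i, which have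
the same measures; n need not lie in D. -/
theorem IsMIPStarSet.exists_subset_shift {k : ℕ} {C : Set ℕ+} (hC : IsMIPStarSet.{u} k C) :
    ∃ D, IsMIPStarSet.{u} k D ∧ D ⊆ C ∧ ∀ n, IsMIPStarSet.{u} k {m | n + m ∈ D} := by
  obtain ⟨X, _, T, μ, A, hT, hA, hpos, hsub⟩ := hC
  refine ⟨_, ⟨X, _, T, μ, A, hT, hA, hpos, subset_rfl⟩, hsub, fun n => ?_⟩
  have hTn := fun i => hT.measurePreserving.iterate i
  refine ⟨X, _, T, μ, fun i => T^[(i : ℕ) * n] ⁻¹' A i, hT, fun i => (hTn _).measurable (hA i),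
    ?_, ?_⟩
  · simpa only [(hTn _).measure_preimage (hA _).nullMeasurableSet] using hpos
  · intro m hm
    simpa only [Set.mem_ofPred_eq, ← Set.preimage_comp, ← Function.iterate_add, ← mul_add,
      PNat.add_coe] using hm

/-- The return set of the rectangles A_i × B_i in the product system is the intersection of the two
return sets. -/
theorem IsMIPStarSet.inter {k : ℕ} {C D : Set ℕ+} (hC : IsMIPStarSet.{u} k C)
    (hD : IsMIPStarSet.{u} k D) : IsMIPStarSet.{u} k (C ∩ D) := by
  obtain ⟨X, _, T, μ, A, hT, hA, hpos, hsub⟩ := hC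
  obtain ⟨Y, _, S, ν, B, hS, hB, hpos', hsub'⟩ := hD
  have := hT.isProbabilityMeasure
  have := hS.isProbabilityMeasure
  refine ⟨X × Y, _, Prod.map T S, μ.prod ν, fun i => A i ×ˢ B i, hT.prod hS,
    fun i => (hA i).prod (hB i), ?_, fun n hn => ?_⟩
  · simp only [Measure.prod_prod, Finset.prod_mul_distrib]
    exact ENNReal.mul_pos hpos.ne' hpos'.ne'
  · have e : ⋂ i : Fin (k + 1), (Prod.map T S)^[(i : ℕ) * n] ⁻¹' A i ×ˢ B i =
        (⋂ i : Fin (k + 1), T^[(i : ℕ) * n] ⁻¹' A i) ×ˢ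
          ⋂ i : Fin (k + 1), S^[(i : ℕ) * n] ⁻¹' B i := by
      ext x
      simp only [Prod.map_iterate, Set.mem_iInter, Set.mem_preimage, Set.mem_prod, Prod.map_fst,
        Prod.map_snd, forall_and]
    rw [Set.mem_ofPred_eq, e, Measure.prod_prod, CanonicallyOrderedAdd.mul_pos] at hn
    exact ⟨hsub hn.1, hsub' hn.2⟩

theorem IsMIPStarSet.dilate {k : ℕ} {C : Set ℕ+} (hC : IsMIPStarSet.{u} k C) (n : ℕ+) :
    IsMIPStarSet.{u} k {m | n * m ∈ C} := by
  obtain ⟨X, _, T, μ, A, hT, hA, hpos, hsub⟩ := hC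
  refine ⟨X, _, T^[(n : ℕ)], μ, A, hT.iterate n, hA, hpos, fun m hm => hsub ?_⟩
  simpa only [Set.mem_ofPred_eq, ← Function.iterate_mul, PNat.mul_coe, mul_left_comm] using hm

end MIPStar

theorem mainTheorem4 (k : ℕ) (hk : 1 ≤ k) :
    IsZFSPFamily {C : Set ℕ+ | IsMIPStarSet.{u} k C} where
  empty_notMem h := by
    obtain ⟨n, hn, -⟩ := IsMIPStarSet.isIPStarSet h Set.univ ⟨Stream'.const 1, Set.subset_univ _⟩
    exact hn
  isIPStarSet _ hA := IsMIPStarSet.isIPStarSet hA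
  exists_subset_shift _ hA := by
    obtain ⟨D, hD, hDA, hs⟩ := IsMIPStarSet.exists_subset_shift hA
    exact ⟨D, hD, hDA, fun n _ => hs n⟩
  inter_mem _ hA _ hB := IsMIPStarSet.inter hA hB
  dilate_mem n _ hA := IsMIPStarSet.dilate hA n
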